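/- All trees are finite. A rooted tree is a tree $T$ with a distinguished root $\rho_T$; its leaves are the vertices of degree $1$, the root is not a leaf, and every non-leaf vertex other than the root has degree at least $3$. (The one-vertex tree is allowed; its leaf set is empty.) A (rooted) triple $ab|c$ consists of an unordered pair $\{a,b\}$ and an element $c$, where $a,b,c$ are pairwise distinct. A rooted tree $T$ displays $ab|c$ if $a,b,c$ are leaves of $T$ and the path from $a$ to $b$ does not intersect the path from $c$ to $\rho_T$; let $\mathcal R(T)$ be the set of triples displayed by $T$. A set $R$ of triples is consistent if $R\subseteq\mathcal R(T)$ for some rooted tree $T$. Let $L_R=\bigcup_{ab|c\in R}\{a,b,c\}$, and for consistent $R$ define the closure $$\operatorname{cl}(R)=\bigcap\{\mathcal R(T) : T \text{ a rooted tree with leaf set } L_R \text{ and } R\subseteq\mathcal R(T)\}.$$ A subset $R'\subseteq R$ is representative for $R$ if $\operatorname{cl}(R')=\operatorname{cl}(R)$, and it is a minimal representative subset if it is inclusion-minimal among the representative subsets of $R$. Let $\mathbb F_R$ be the family of all sets $R''$ such that $R''\subseteq R'$ for some minimal representative subset $R'$ of $R$. Theorem. If $R$ is a finite consistent set of triples,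 then $(R,\mathbb F_R)$ is a matroid, i.e. $\mathbb F_R$ is the family of independent sets of a matroid with ground set $R$. -/

import Mathlib

universe u

/-- A rooted triple `ab|c` on taxa in `X`: the unordered pair `{a, b}` together with the
third leaf `c`, where `a`, `b`, `c` are pairwise distinct (so `ab|c` and `ba|c` are equal). -/
@[ext]
structure RootedTriple (X : Type u) where
  pair : Sym2 X
  out : X
  pair_not_diag : ¬ pair.IsDiag
  out_notMem : out ∉ pair

/-- The set of the three leaves of a triple. -/
def RootedTriple.leaves {X : Type u} (t : RootedTriple X) : Set X :=
  {x | x ∈ t.pair ∨ x = t.out}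

/-- A finite rooted tree whose leaves (the vertices of degree one) are labelled bijectively by a
set `leafSet` of taxa. The root is an inner vertex, and every other inner vertex has degree at
least three. (The one-vertex tree is allowed; its leaf set is empty.) -/
structure PhyloTree (X : Type u) where
  V : Type
  [fintypeV : Fintype V]
  graph : SimpleGraph V
  [decAdj : DecidableRel graph.Adj]
  isTree : graph.IsTree
  root : V
  root_inner : graph.degree root ≠ 1
  inner_degree : ∀ v, v ≠ root → graph.degree v ≠ 1 → 3 ≤ graph.degree v
  leafSet : Set X
  leaf : leafSet → V
  leaf_injective : Function.Injective leaf
  range_leaf : Set.range leaf = {v | graph.degree v = 1}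

namespace PhyloTree

variable {X : Type u}

/-- The vertices on the path between `u` and `v` (which is unique, the graph being a tree). -/
def pathVertices (T : PhyloTree X) (u v : T.V) : Set T.V :=
  {w | ∃ p : T.graph.Walk u v, p.IsPath ∧ w ∈ p.support}

/-- `T` displays `ab|c`: `a`, `b`, `c` are leaves of `T`, and the path from `a` to `b` does not
intersect the path from `c` to the root. -/
def Displays (T : PhyloTree X) (t : RootedTriple X) : Prop :=
  ∃ a b c : T.leafSet, t.pair = s((a : X), (b : X)) ∧ t.out = (c : X) ∧
    Disjoint (T.pathVertices (T.leaf a) (T.leaf b)) (T.pathVertices (T.leaf c) T.root)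

/-- The set of all triples displayed by `T`. -/
def triples (T : PhyloTree X) : Set (RootedTriple X) :=
  {t | T.Displays t}

end PhyloTree

namespace TripleSet

variable {X : Type u}

/-- A triple set is consistent if some rooted tree displays all of its triples. -/
def Consistent (R : Set (RootedTriple X)) : Prop :=
  ∃ T : PhyloTree X, R ⊆ T.triples

/-- The set `L_R` of all leaves of triples in `R`. -/
def leafSet (R : Set (RootedTriple X)) : Set X :=
  ⋃ t ∈ R, t.leaves

/-- All rooted trees with leaf set `L_R` that display `R`. -/
def span (R : Set (RootedTriple X)) : Set (PhyloTree X) :=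
  {T | T.leafSet = leafSet R ∧ R ⊆ T.triples}

/-- The closure `cl(R)`: the triples displayed by all trees in `span R`. -/
def cl (R : Set (RootedTriple X)) : Set (RootedTriple X) :=
  ⋂ T ∈ span R, T.triples

/-- The representative subsets of `R`, i.e. those with the same closure as `R`. -/
def sc (R : Set (RootedTriple X)) : Set (Set (RootedTriple X)) :=
  {R' | R' ⊆ R ∧ cl R' = cl R}

/-- The inclusion-minimal representative subsets of `R`. -/
def minSc (R : Set (RootedTriple X)) : Set (Set (RootedTriple X)) :=
  {R' | Minimal (fun S => S ∈ sc R) R'}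

/-- The family `𝔽_R` of all subsets of minimal representative subsets of `R`. -/
def indepFamily (R : Set (RootedTriple X)) : Set (Set (RootedTriple X)) :=
  {R'' | ∃ R' ∈ minSc R, R'' ⊆ R'}

end TripleSet

/-! The matroid is graphic. Take the ordered pairs of taxa as vertices, and let a triple `ab|c` be
an edge from `(a, c)` to `(b, c)`. Add base edges (`BaseAdj`) that depend only on `cl R`; every edge
joins pairs that branch at the same vertex in the same direction. By `cl_eq_iff`, `S ⊆ R` is
representative exactly when base edges and edges of `S` connect the two ends of every edge of `R`.
After contraction of the base edges, the minimal such `S` are the spanning forests of a graph,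
realised as bases among vectors over `ℚ` (`exists_matroid_of_connectivity`).

The criterion rests on a description of the closure (`mem_cl_iff`): `ab|c` lies in `cl S` iff, on
some set of taxa, the Aho graph of `S` has only the component of `a`, `b` and that of `c`. An Aho
path from `a` to `b` lifts to a path of pairs (`eqvGen_of_inferred`). Conversely, if all triples of
the closure have connected pairs, projection to first coordinates gives Aho paths, by induction on
the number of taxa below the branching (`ahoConn_of_eqvGen`). Trees enter only through their
clusters, which form a laminar family. -/

/-! ### Laminar families and the triples they separate -/

/-- Any two members of the family that meet are nested. -/
def IsLaminar {X : Type u} (F : Set (Set X)) : Prop :=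
  ∀ C ∈ F, ∀ D ∈ F, (C ∩ D).Nonempty → C ⊆ D ∨ D ⊆ C

/-- Some member of the family contains `a` and `b` but not `c`. -/
def Separates {X : Type u} (F : Set (Set X)) (a b c : X) : Prop :=
  ∃ C ∈ F, a ∈ C ∧ b ∈ C ∧ c ∉ C

namespace Separates

variable {X : Type u} {F : Set (Set X)} {a b c d : X}

theorem symm (h : Separates F a b c) : Separates F b a c := by
  obtain ⟨C, hC, h1, h2, h3⟩ := h
  exact ⟨C, hC, h2, h1, h3⟩

theorem ne_left (h : Separates F a b c) : a ≠ c := by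
  obtain ⟨C, hC, h1, h2, h3⟩ := h
  rintro rfl
  exact h3 h1

theorem trans_out (hF : IsLaminar F) (h : Separates F a b c) (h' : Separates F b c d) :
    Separates F a b d := by
  obtain ⟨C, hC, h1, h2, h3⟩ := h
  obtain ⟨D, hD, h4, h5, h6⟩ := h'
  rcases hF C hC D hD ⟨b, h2, h4⟩ with h | h
  · exact ⟨C, hC, h1, h2, fun hd => h6 (h hd)⟩
  · exact absurd (h h5) h3

theorem trans_in (hF : IsLaminar F) (h : Separates F a b c) (h' : Separates F a d c) :
    Separates F b d c := by
  obtain ⟨C, hC, h1, h2, h3⟩ := h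
  obtain ⟨D, hD, h4, h5, h6⟩ := h'
  rcases hF C hC D hD ⟨a, h1, h4⟩ with h | h
  · exact ⟨D, hD, h h2, h5, h6⟩
  · exact ⟨C, hC, h2, h h5, h3⟩

/-- The two clusters are disjoint: each has a taxon that the other misses, so laminarity forbids
them to meet. -/
theorem cross (hF : IsLaminar F) (h : Separates F a b c) (h' : Separates F c d a) :
    Separates F a b d := by
  obtain ⟨C, hC, h1, h2, h3⟩ := h
  obtain ⟨D, hD, h4, h5, h6⟩ := h'
  refine ⟨C, hC, h1, h2, fun hd => ?_⟩
  rcases hF C hC D hD ⟨d, hd, h5⟩ with h | h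
  · exact h6 (h h1)
  · exact h3 (h h4)

theorem asymm (hF : IsLaminar F) (h : Separates F a b c) : ¬ Separates F a c b := by
  rintro ⟨D, hD, h4, h5, h6⟩
  obtain ⟨C, hC, h1, h2, h3⟩ := h
  rcases hF C hC D hD ⟨a, h1, h4⟩ with h | h
  · exact h6 (h h2)
  · exact h3 (h h5)

end Separates

/-! ### Aho graphs and inferred triples -/

section Aho

variable {X : Type u} {ρ : X → X → X → Prop} {L L₀ L₁ : Set X}

/-- The adjacency relation of the Aho graph `[ρ, L]`. -/
def AhoAdj (ρ : X → X → X → Prop) (L : Set X) (x y : X) : Prop :=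
  x ∈ L ∧ y ∈ L ∧ ∃ z ∈ L, ρ x y z

/-- `x` and `y` lie in one component of the Aho graph `[ρ, L]`. -/
def AhoConn (ρ : X → X → X → Prop) (L : Set X) : X → X → Prop :=
  Relation.EqvGen (AhoAdj ρ L)

/-- On some subset of `L₀` the Aho graph has the component of `a` and `b` and the component of `c`,
and no others. -/
def Inferred (ρ : X → X → X → Prop) (L₀ : Set X) (a b c : X) : Prop :=
  ∃ L ⊆ L₀, a ∈ L ∧ b ∈ L ∧ c ∈ L ∧ AhoConn ρ L a b ∧ ∀ x ∈ L, AhoConn ρ L x a ∨ AhoConn ρ L x c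

theorem AhoConn.refl (x : X) : AhoConn ρ L x x := Relation.EqvGen.refl x

theorem AhoConn.symm {x y : X} (h : AhoConn ρ L x y) : AhoConn ρ L y x :=
  Relation.EqvGen.symm _ _ h

theorem AhoConn.trans {x y z : X} (h : AhoConn ρ L x y) (h' : AhoConn ρ L y z) :
    AhoConn ρ L x z := Relation.EqvGen.trans _ _ _ h h'

theorem AhoConn.of_adj {x y : X} (h : AhoAdj ρ L x y) : AhoConn ρ L x y :=
  Relation.EqvGen.rel _ _ h

theorem AhoConn.mono (h : L ⊆ L₁) {x y : X} (hc : AhoConn ρ L x y) : AhoConn ρ L₁ x y := by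
  refine Relation.EqvGen.mono ?_ _ _ hc
  rintro x y ⟨hx, hy, z, hz, hr⟩
  exact ⟨h hx, h hy, z, h hz, hr⟩

theorem Inferred.mono (h : L₀ ⊆ L₁) {a b c : X} (hi : Inferred ρ L₀ a b c) :
    Inferred ρ L₁ a b c := by
  obtain ⟨L, hL, h⟩ := hi
  exact ⟨L, hL.trans ‹_›, h⟩

/-- A set that is closed under adjacency in both directions is a union of components. -/
theorem AhoConn.mem_iff {D : Set X} (hD : ∀ x y, AhoAdj ρ L x y → (x ∈ D ↔ y ∈ D)) {x y : X}
    (h : AhoConn ρ L x y) : x ∈ D ↔ y ∈ D := by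
  induction h with
  | rel x y h => exact hD x y h
  | refl x => rfl
  | symm x y _ ih => exact ih.symm
  | trans x y z _ _ ih1 ih2 => exact ih1.trans ih2

theorem AhoConn.mem_left_iff {x y : X} (h : AhoConn ρ L x y) : x ∈ L ↔ y ∈ L :=
  h.mem_iff fun _ _ h => ⟨fun _ => h.2.1, fun _ => h.1⟩

theorem AhoConn.eq_or_exists {x y : X} (h : AhoConn ρ L x y) :
    x = y ∨ ∃ z, AhoAdj ρ L x z ∨ AhoAdj ρ L z x := by
  by_contra! hc
  have := (h.mem_iff (D := {x}) fun u v huv => by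
    simp only [Set.mem_singleton_iff]
    constructor <;> rintro rfl
    · exact absurd huv (hc.2 v).1
    · exact absurd huv (hc.2 u).2).1 rfl
  exact hc.1 this.symm

/-- Inferred triples are displayed by every finite laminar family that displays `ρ`. -/
theorem Inferred.separates {F : Set (Set X)} (hfin : F.Finite) (hF : IsLaminar F)
    (hρ : ∀ a b c, ρ a b c → Separates F a b c) {a b c : X} (hab : a ≠ b)
    (h : Inferred ρ L₀ a b c) : Separates F a b c := by
  obtain ⟨L, -, ha, hb, hc, hconn, hall⟩ := h
  have hfin' : {D | D ⊂ L ∧ a ∈ D ∧ ∃ C ∈ F, C ∩ L = D}.Finite :=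
    (hfin.image (· ∩ L)).subset fun D hD => hD.2.2
  by_cases hne : {D | D ⊂ L ∧ a ∈ D ∧ ∃ C ∈ F, C ∩ L = D}.Nonempty
  -- A maximal proper trace `D` around `a` is a union of Aho components: a cluster of an edge that
  -- meets it is nested with `C`, hence has its trace inside `D`. So `D` contains `b`, and with `c`
  -- it would be all of `L`.
  · obtain ⟨D, ⟨hDL, haD, C, hC, hCD⟩, hmax⟩ := hfin'.exists_maximal hne
    have key : ∀ x y z, x ∈ L → y ∈ L → z ∈ L → Separates F x y z → x ∈ D → y ∈ D := by
      rintro x y z hx hy hz ⟨C', hC', hx', hy', hz'⟩ hxD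
      have hxC : x ∈ C := (hCD ▸ hxD : x ∈ C ∩ L).1
      rcases hF C hC C' hC' ⟨x, hxC, hx'⟩ with h | h
      · have haC : a ∈ C := (hCD ▸ haD : a ∈ C ∩ L).1
        have := hmax (y := C' ∩ L) ⟨⟨Set.inter_subset_right, fun h => hz' (h hz).1⟩,
          ⟨h haC, ha⟩, C', hC', rfl⟩ (by
            rw [← hCD]; exact Set.inter_subset_inter_left _ h)
        exact this ⟨hy', hy⟩
      · rw [← hCD]; exact ⟨h hy', hy⟩
    have hD : ∀ x y, AhoConn ρ L x y → (x ∈ D ↔ y ∈ D) := fun x y h => h.mem_iff (by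
      rintro x y ⟨hx, hy, z, hz, hr⟩
      exact ⟨key x y z hx hy hz (hρ _ _ _ hr), key y x z hy hx hz (hρ _ _ _ hr).symm⟩)
    refine ⟨C, hC, (hCD ▸ haD : a ∈ C ∩ L).1, (hCD ▸ (hD _ _ hconn).1 haD : b ∈ C ∩ L).1, ?_⟩
    intro hcC
    have hcD : c ∈ D := hCD ▸ ⟨hcC, hc⟩
    refine hDL.2 fun x hx => ?_
    rcases hall x hx with h | h
    · exact (hD _ _ h).2 haD
    · exact (hD _ _ h).2 hcD
  -- Now no cluster containing `a` splits `L`, yet `a ≠ b` are connected, so `a` has an Aho edge,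
  -- whose triple provides such a cluster.
  · exfalso
    have hsep : ∀ y z, y ∈ L → z ∈ L → ¬ Separates F a y z := by
      rintro y z hy hz ⟨C, hC, h1, h2, h3⟩
      exact hne ⟨C ∩ L, ⟨Set.inter_subset_right, fun h => h3 (h hz).1⟩, ⟨h1, ha⟩, C, hC, rfl⟩
    rcases hconn.eq_or_exists with h | ⟨y, ⟨-, hy, z, hz, hr⟩ | ⟨hy, -, z, hz, hr⟩⟩
    · exact hab h
    · exact hsep y z hy hz (hρ _ _ _ hr)
    · exact hsep y z hy hz (hρ _ _ _ hr).symm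

/-- Join a laminar family on a union `E` of components with the traces of another laminar family
on the remaining components. -/
theorem exists_laminar_of_union_of_components {F G : Set (Set X)} (hF : IsLaminar F)
    (hG : IsLaminar G) {E : Set X} (hE : ∀ x y, AhoConn ρ L x y → (x ∈ E ↔ y ∈ E))
    (hFρ : ∀ x y z, ρ x y z → Separates F x y z)
    (hGρ : ∀ x y z, x ∈ E → y ∈ E → z ∈ E → ρ x y z → Separates G x y z) :
    ∃ H : Set (Set X), IsLaminar H ∧
      (∀ x y z, x ∈ L → y ∈ L → z ∈ L → ρ x y z → Separates H x y z) ∧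
      (∀ x y z, x ∈ E → y ∈ E → z ∈ E → Separates H x y z → Separates G x y z) ∧
      (∀ x y z, x ∉ E → Separates H x y z → AhoConn ρ L x y) := by
  set comp : X → Set X := fun w => {x | AhoConn ρ L x w} with hcomp
  -- The member `E` itself is needed for triples of `ρ` with their pair in `E` and the third taxon
  -- outside.
  refine ⟨{D | (∃ C ∈ G, D = C ∩ E) ∨ D = E ∨ (∃ w, w ∉ E ∧ D = comp w) ∨
    ∃ w C, w ∉ E ∧ C ∈ F ∧ D = C ∩ comp w}, ?_, ?_, ?_, ?_⟩
  · have hdis : ∀ w, w ∉ E → ∀ x, x ∈ E → x ∈ comp w → False :=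
      fun w hw x hx hxw => hw ((hE _ _ hxw).1 hx)
    have hcc : ∀ w w' x, x ∈ comp w → x ∈ comp w' → comp w = comp w' := by
      intro w w' x h h'
      ext y
      exact ⟨fun hy => AhoConn.trans (AhoConn.trans hy (AhoConn.symm h)) h',
        fun hy => AhoConn.trans (AhoConn.trans hy (AhoConn.symm h')) h⟩
    rintro C hC D hD ⟨x, hx, hx'⟩
    rcases hC with ⟨C, hC, rfl⟩ | rfl | ⟨w, hw, rfl⟩ | ⟨w, C, hw, hC, rfl⟩ <;>
    rcases hD with ⟨D, hD, rfl⟩ | rfl | ⟨w', hw', rfl⟩ | ⟨w', D, hw', hD, rfl⟩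
    · rcases hG C hC D hD ⟨x, hx.1, hx'.1⟩ with h | h
      · exact .inl (Set.inter_subset_inter_left _ h)
      · exact .inr (Set.inter_subset_inter_left _ h)
    · exact .inl Set.inter_subset_right
    · exact (hdis _ hw' _ hx.2 hx').elim
    · exact (hdis _ hw' _ hx.2 hx'.2).elim
    · exact .inr Set.inter_subset_right
    · exact .inl subset_rfl
    · exact (hdis _ hw' _ hx hx').elim
    · exact (hdis _ hw' _ hx hx'.2).elim
    · exact (hdis _ hw _ hx'.2 hx).elim
    · exact (hdis _ hw _ hx' hx).elim
    · exact .inl (hcc _ _ _ hx hx').subset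
    · exact .inr (by rw [hcc _ _ _ hx hx'.2]; exact Set.inter_subset_right)
    · exact (hdis _ hw _ hx'.2 hx.2).elim
    · exact (hdis _ hw _ hx' hx.2).elim
    · exact .inl (by rw [hcc _ _ _ hx' hx.2]; exact Set.inter_subset_right)
    · rw [hcc _ _ _ hx'.2 hx.2]
      rcases hF C hC D hD ⟨x, hx.1, hx'.1⟩ with h | h
      · exact .inl (Set.inter_subset_inter_left _ h)
      · exact .inr (Set.inter_subset_inter_left _ h)
  · intro x y z hx hy hz hr
    have hxy : AhoConn ρ L x y := .of_adj ⟨hx, hy, z, hz, hr⟩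
    by_cases hxE : x ∈ E
    · have hyE := (hE _ _ hxy).1 hxE
      by_cases hzE : z ∈ E
      · obtain ⟨C, hC, h1, h2, h3⟩ := hGρ x y z hxE hyE hzE hr
        exact ⟨C ∩ E, .inl ⟨C, hC, rfl⟩, ⟨h1, hxE⟩, ⟨h2, hyE⟩, fun h => h3 h.1⟩
      · exact ⟨E, .inr (.inl rfl), hxE, hyE, hzE⟩
    · obtain ⟨C, hC, h1, h2, h3⟩ := hFρ x y z hr
      exact ⟨C ∩ comp x, .inr (.inr (.inr ⟨x, C, hxE, hC, rfl⟩)), ⟨h1, AhoConn.refl x⟩,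
        ⟨h2, hxy.symm⟩, fun h => h3 h.1⟩
  · rintro x y z hx hy hz ⟨D, ⟨C, hC, rfl⟩ | rfl | ⟨w, hw, rfl⟩ | ⟨w, C, hw, hC, rfl⟩, h1, h2, h3⟩
    · exact ⟨C, hC, h1.1, h2.1, fun h => h3 ⟨h, hz⟩⟩
    · exact absurd hz h3
    · exact absurd ((hE _ _ h1).1 hx) hw
    · exact absurd ((hE _ _ h1.2).1 hx) hw
  · rintro x y z hx ⟨D, ⟨C, hC, rfl⟩ | rfl | ⟨w, hw, rfl⟩ | ⟨w, C, hw, hC, rfl⟩, h1, h2, h3⟩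
    · exact absurd h1.2 hx
    · exact absurd h1 hx
    · exact AhoConn.trans h1 (AhoConn.symm h2)
    · exact AhoConn.trans h1.2 (AhoConn.symm h2.2)

/-- A triple that is not inferred can be avoided. -/
theorem exists_laminar_of_not_inferred {F : Set (Set X)} (hF : IsLaminar F)
    (hρ : ∀ a b c, ρ a b c → Separates F a b c) {a b c : X} (L : Set X)
    (hL : L.Finite) (ha : a ∈ L) (hb : b ∈ L) (hc : c ∈ L) (h : ¬ Inferred ρ L a b c) :
    ∃ H : Set (Set X), IsLaminar H ∧
      (∀ x y z, x ∈ L → y ∈ L → z ∈ L → ρ x y z → Separates H x y z) ∧ ¬ Separates H a b c := by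
  induction hn : L.ncard using Nat.strong_induction_on generalizing L with
  | _ n ih =>
  by_cases hab' : AhoConn ρ L a b
  -- Since `L` does not witness the inference, these components do not exhaust `L`. A family on `E`
  -- avoiding the triple exists by induction and extends to `L`.
  · set E : Set X := {x ∈ L | AhoConn ρ L x a ∨ AhoConn ρ L x c} with hEdef
    have hEL : E ⊂ L := by
      refine ⟨Set.sep_subset _ _, fun hLE => h ⟨L, subset_rfl, ha, hb, hc, hab', fun x hx => ?_⟩⟩
      exact (hLE hx).2
    obtain ⟨G, hG, hGρ, hGsep⟩ := ih E.ncard (hn ▸ Set.ncard_lt_ncard hEL hL) E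
      (hL.subset hEL.1) ⟨ha, .inl (.refl a)⟩ ⟨hb, .inl hab'.symm⟩ ⟨hc, .inr (.refl c)⟩
      (fun hi => h (hi.mono hEL.1)) rfl
    have hE : ∀ x y, AhoConn ρ L x y → x ∈ E → y ∈ E := by
      rintro x y hxy ⟨hx, hx'⟩
      exact ⟨hxy.mem_left_iff.1 hx, hx'.imp hxy.symm.trans hxy.symm.trans⟩
    obtain ⟨H, hH, h1, h2, -⟩ := exists_laminar_of_union_of_components hF hG
      (fun x y hxy => ⟨hE x y hxy, hE y x hxy.symm⟩) hρ hGρ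
    exact ⟨H, hH, h1, fun hs => hGsep (h2 a b c ⟨ha, .inl (.refl a)⟩ ⟨hb, .inl hab'.symm⟩
      ⟨hc, .inr (.refl c)⟩ hs)⟩
  -- With `E = ∅` every cluster lies in one component, so none contains both `a` and `b`.
  · obtain ⟨H, hH, h1, -, h3⟩ := exists_laminar_of_union_of_components (L := L) (E := ∅) hF hF
      (by simp) hρ (by simp)
    exact ⟨H, hH, h1, fun hs => hab' (h3 a b c (by simp) hs)⟩

end Aho

/-! ### Paths and clusters in a tree -/

namespace PhyloTree

variable {X : Type u} (T : PhyloTree X)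

theorem path_support_eq {u v : T.V} {p q : T.graph.Walk u v} (hp : p.IsPath) (hq : q.IsPath) :
    p.support = q.support :=
  congrArg SimpleGraph.Walk.support ((T.isTree.existsUnique_path u v).unique hp hq)

theorem mem_pathVertices {u v w : T.V} {p : T.graph.Walk u v} (hp : p.IsPath) :
    w ∈ T.pathVertices u v ↔ w ∈ p.support := by
  constructor
  · rintro ⟨q, hq, hw⟩
    rwa [T.path_support_eq hp hq]
  · exact fun h => ⟨p, hp, h⟩

theorem pathVertices_subset_of_walk {u v : T.V} (p : T.graph.Walk u v) {w : T.V}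
    (hw : w ∈ T.pathVertices u v) : w ∈ p.support := by
  classical
  exact p.support_bypass_subset_support ((T.mem_pathVertices p.bypass_isPath).1 hw)

theorem exists_isPath (u v : T.V) : ∃ p : T.graph.Walk u v, p.IsPath :=
  (T.isTree.existsUnique_path u v).exists

theorem pathVertices_comm (u v : T.V) : T.pathVertices u v = T.pathVertices v u := by
  obtain ⟨p, hp⟩ := T.exists_isPath u v
  ext w
  rw [T.mem_pathVertices hp, T.mem_pathVertices hp.reverse]
  simp

theorem left_mem_pathVertices (u v : T.V) : u ∈ T.pathVertices u v := by
  obtain ⟨p, hp⟩ := T.exists_isPath u v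
  exact ⟨p, hp, p.start_mem_support⟩

theorem pathVertices_subset_right {u v w : T.V} (hw : w ∈ T.pathVertices u v) :
    T.pathVertices w v ⊆ T.pathVertices u v := by
  classical
  obtain ⟨p, hp, hw⟩ := hw
  intro x hx
  exact ⟨p, hp, p.support_dropUntil_subset_support hw
    ((T.mem_pathVertices (hp.dropUntil hw)).1 hx)⟩

theorem pathVertices_subset_left {u v w : T.V} (hw : w ∈ T.pathVertices u v) :
    T.pathVertices u w ⊆ T.pathVertices u v := by
  rw [T.pathVertices_comm u w, T.pathVertices_comm u v]
  exact T.pathVertices_subset_right (T.pathVertices_comm u v ▸ hw)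

theorem mem_pathVertices_or {u v x : T.V} (hx : x ∈ T.pathVertices u v) (w : T.V) :
    x ∈ T.pathVertices u w ∨ x ∈ T.pathVertices w v := by
  obtain ⟨p, hp⟩ := T.exists_isPath u w
  obtain ⟨q, hq⟩ := T.exists_isPath w v
  have := T.pathVertices_subset_of_walk (p.append q) hx
  rw [SimpleGraph.Walk.mem_support_append_iff] at this
  exact this.imp (T.mem_pathVertices hp).2 (T.mem_pathVertices hq).2

theorem mem_pathVertices_trans {u v x y : T.V} (hx : x ∈ T.pathVertices u v)
    (hy : y ∈ T.pathVertices u v) : y ∈ T.pathVertices x v ∨ x ∈ T.pathVertices y v := by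
  classical
  obtain ⟨p, hp, hx⟩ := hx
  rw [T.mem_pathVertices hp, ← p.take_spec hx, SimpleGraph.Walk.mem_support_append_iff] at hy
  rcases hy with hy | hy
  · right
    have h1 := hp.takeUntil hx
    refine ⟨((p.takeUntil x hx).dropUntil y hy).append (p.dropUntil x hx), ?_, ?_⟩
    · have : (((p.takeUntil x hx).takeUntil y hy).append
          (((p.takeUntil x hx).dropUntil y hy).append (p.dropUntil x hx))).IsPath := by
        rw [SimpleGraph.Walk.append_assoc, SimpleGraph.Walk.take_spec,
          SimpleGraph.Walk.take_spec]
        exact hp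
      exact this.of_append_right
    · rw [SimpleGraph.Walk.mem_support_append_iff]
      exact .inl (SimpleGraph.Walk.end_mem_support _)
  · exact .inl ⟨_, hp.dropUntil hx, hy⟩

/-- Three vertices of a tree have a median. -/
theorem exists_median (u v r : T.V) :
    ∃ w, w ∈ T.pathVertices u v ∧ w ∈ T.pathVertices u r ∧ w ∈ T.pathVertices v r := by
  classical
  obtain ⟨p, hp⟩ := T.exists_isPath u r
  suffices H : ∃ w, w ∈ T.pathVertices u v ∧ w ∈ p.support ∧ w ∈ T.pathVertices v r by
    obtain ⟨w, h1, h2, h3⟩ := H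
    exact ⟨w, h1, ⟨p, hp, h2⟩, h3⟩
  clear hp
  induction p with
  | nil => exact ⟨_, T.left_mem_pathVertices _ _, by simp, by
      rw [T.pathVertices_comm]; exact T.left_mem_pathVertices _ _⟩
  | @cons u u' r h p ih =>
    -- The median for `u'` also serves for its neighbour `u`, unless `u` lies on the path from `v`
    -- to `r`; then `u` is the median.
    obtain ⟨w, h1, h2, h3⟩ := ih
    by_cases hu : u ∈ T.pathVertices v r
    · exact ⟨u, T.left_mem_pathVertices _ _, by simp, hu⟩
    by_cases hu' : u ∈ T.pathVertices u' v
    · rcases T.mem_pathVertices_trans hu' h1 with h4 | h4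
      · exact ⟨w, h4, by simp [h2], h3⟩
      · rw [T.pathVertices_comm] at h4
        exact absurd (T.pathVertices_subset_left h3 h4) hu
    · obtain ⟨q, hq, hw⟩ := h1
      refine ⟨w, ⟨q.cons h, hq.cons fun hc => hu' ⟨q, hq, hc⟩, ?_⟩, by simp [h2], h3⟩
      simp [hw]

/-- The taxa below the vertex `v`. -/
def cluster (v : T.V) : Set X :=
  {x | ∃ h : x ∈ T.leafSet, v ∈ T.pathVertices (T.leaf ⟨x, h⟩) T.root}

/-- The family of the clusters of a tree. -/
def clusters : Set (Set X) := Set.range T.cluster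

theorem finite_clusters : T.clusters.Finite := by
  have := T.fintypeV
  exact Set.finite_range _

theorem isLaminar_clusters : IsLaminar T.clusters := by
  have key : ∀ u v : T.V, v ∈ T.pathVertices u T.root → T.cluster u ⊆ T.cluster v := by
    rintro u v h x ⟨hx, hu⟩
    exact ⟨hx, T.pathVertices_subset_right hu h⟩
  rintro _ ⟨u, rfl⟩ _ ⟨v, rfl⟩ ⟨x, ⟨hx, hu⟩, ⟨_, hv⟩⟩
  exact (T.mem_pathVertices_trans hu hv).imp (key u v) (key v u)

/-- The median of `a`, `b`, `r` is their last common ancestor and lies on both paths to `r`.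
Conversely, each vertex between `a` and `b` is below every common ancestor `v`, so if the path from
`c` met it, that path would go on through `v`. -/
theorem disjoint_pathVertices_iff (a b c r : T.V) :
    Disjoint (T.pathVertices a b) (T.pathVertices c r) ↔
      ∃ v, v ∈ T.pathVertices a r ∧ v ∈ T.pathVertices b r ∧ v ∉ T.pathVertices c r := by
  constructor
  · intro h
    obtain ⟨v, h1, h2, h3⟩ := T.exists_median a b r
    exact ⟨v, h2, h3, fun h4 => Set.disjoint_left.1 h h1 h4⟩
  · rintro ⟨v, h1, h2, h3⟩
    refine Set.disjoint_left.2 fun w hw hwc => h3 ?_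
    suffices v ∈ T.pathVertices w r from T.pathVertices_subset_right hwc this
    have key : ∀ a, v ∈ T.pathVertices a r → w ∈ T.pathVertices a v → v ∈ T.pathVertices w r := by
      intro a hv hw
      rcases T.mem_pathVertices_trans hv (T.pathVertices_subset_left hv hw) with h | h
      · have : w = v := by
          by_contra hne
          classical
          obtain ⟨p, hp, hv⟩ := hv
          rw [← p.take_spec hv] at hp
          exact hp.ne_of_mem_support_of_append hne
            ((T.mem_pathVertices hp.of_append_left).1 hw)
            ((T.mem_pathVertices hp.of_append_right).1 h) rfl
        rw [this]
        exact T.left_mem_pathVertices _ _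
      · exact h
    rcases T.mem_pathVertices_or hw v with h | h
    · exact key a h1 h
    · exact key b h2 (T.pathVertices_comm v b ▸ h)

theorem mem_triples_iff (t : RootedTriple X) : t ∈ T.triples ↔
    t.leaves ⊆ T.leafSet ∧ ∀ a b, t.pair = s(a, b) → Separates T.clusters a b t.out := by
  constructor
  · rintro ⟨⟨a, ha⟩, ⟨b, hb⟩, ⟨c, hc⟩, h1, h2, h3⟩
    rw [disjoint_pathVertices_iff] at h3
    obtain ⟨v, hva, hvb, hvc⟩ := h3
    have hs : Separates T.clusters a b t.out :=
      ⟨_, ⟨v, rfl⟩, ⟨ha, hva⟩, ⟨hb, hvb⟩, fun ⟨h, h'⟩ => hvc (by simpa [h2] using h')⟩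
    refine ⟨?_, ?_⟩
    · rintro x (hx | hx)
      · rw [h1, Sym2.mem_iff] at hx
        rcases hx with rfl | rfl <;> assumption
      · rw [hx, h2]; exact hc
    · intro a' b' h
      rw [h1, Sym2.eq_iff] at h
      rcases h with ⟨rfl, rfl⟩ | ⟨rfl, rfl⟩
      · exact hs
      · exact hs.symm
  · rintro ⟨h1, h2⟩
    obtain ⟨a, b, hab⟩ : ∃ a b, t.pair = s(a, b) := t.pair.ind fun a b => ⟨a, b, rfl⟩
    obtain ⟨_, ⟨v, rfl⟩, ⟨ha, hva⟩, ⟨hb, hvb⟩, hc⟩ := h2 a b hab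
    have hcL : t.out ∈ T.leafSet := h1 (.inr rfl)
    refine ⟨⟨a, ha⟩, ⟨b, hb⟩, ⟨t.out, hcL⟩, hab, rfl, ?_⟩
    rw [disjoint_pathVertices_iff]
    exact ⟨v, hva, hvb, fun h => hc ⟨hcL, h⟩⟩

end PhyloTree

/-! ### From laminar families to trees -/

section ParentGraph

variable {V : Type} {X : Type u}

/-- The graph joining each vertex to its parent. -/
def parentGraph (p : V → V) : SimpleGraph V := SimpleGraph.fromRel fun u v => p u = v

/-- A system of clusters on the finite set `L`, with the function sending each cluster to the
smallest cluster properly containing it. -/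
structure ClusterSystem (V : Type) (X : Type u) where
  L : Finset X
  cl : V → Finset X
  root : V
  parent : V → V
  cl_injective : Function.Injective cl
  cl_root : cl root = L
  cl_subset : ∀ v, cl v ⊆ L
  -- The root is exempt because `L = ∅` must yield the one-vertex tree.
  cl_nonempty : ∀ v, v ≠ root → (cl v).Nonempty
  exists_singleton : ∀ x ∈ L, ∃ v, cl v = {x}
  ne_singleton : ∀ x, L ≠ {x}
  parent_root : parent root = root
  ssubset_parent : ∀ v, v ≠ root → cl v ⊂ cl (parent v)
  parent_subset : ∀ v w, cl v ⊂ cl w → cl (parent v) ⊆ cl w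

namespace ClusterSystem

variable (S : ClusterSystem V X)

def graph : SimpleGraph V := parentGraph S.parent

theorem parent_ne {v : V} (hv : v ≠ S.root) : S.parent v ≠ v := fun h => by
  have := S.ssubset_parent v hv
  rw [h] at this
  exact this.2 subset_rfl

theorem adj_iff {u v : V} : S.graph.Adj u v ↔ u ≠ v ∧ (S.parent u = v ∨ S.parent v = u) :=
  SimpleGraph.fromRel_adj _ _ _

theorem adj_parent {v : V} (hv : v ≠ S.root) : S.graph.Adj v (S.parent v) :=
  S.adj_iff.2 ⟨(S.parent_ne hv).symm, .inl rfl⟩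

/-- Iterating `parent` gives the path. It misses no larger cluster, as the parent has the least
cluster properly above. Applied to leaves, this identifies the tree's clusters with `cl`. -/
theorem exists_isPath (v : V) : ∃ q : S.graph.Walk v S.root, q.IsPath ∧
    ∀ w, w ∈ q.support ↔ S.cl v ⊆ S.cl w := by
  induction hn : S.L.card - (S.cl v).card using Nat.strong_induction_on generalizing v with
  | _ n ih =>
  by_cases hv : v = S.root
  · subst hv
    refine ⟨.nil, .nil, fun w => ?_⟩
    rw [SimpleGraph.Walk.mem_support_nil_iff]
    exact ⟨fun h => h ▸ subset_rfl, fun h =>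
      S.cl_injective ((S.cl_root ▸ S.cl_subset w).antisymm h)⟩
  · have hs := S.ssubset_parent v hv
    have h1 := Finset.card_lt_card hs
    have h2 := Finset.card_le_card (S.cl_subset (S.parent v))
    obtain ⟨q, hq, hqs⟩ := ih _ (by omega) (S.parent v) rfl
    refine ⟨q.cons (S.adj_parent hv), hq.cons fun h => hs.2 ((hqs v).1 h), fun w => ?_⟩
    rw [SimpleGraph.Walk.support_cons, List.mem_cons, hqs]
    constructor
    · rintro (rfl | h)
      · exact subset_rfl
      · exact hs.1.trans h
    · intro h
      by_cases hw : w = v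
      · exact .inl hw
      · exact .inr (S.parent_subset v w (h.ssubset_of_ne fun h => hw (S.cl_injective h.symm)))

/-- All vertices are joined to the root, and each edge comes from a non-root vertex, so there are at
most `|V| - 1` edges. -/
theorem isTree [Finite V] : S.graph.IsTree := by
  classical
  have := Fintype.ofFinite V
  have hconn : S.graph.Connected := by
    have : Nonempty V := ⟨S.root⟩
    refine ⟨fun u v => ?_⟩
    obtain ⟨p, -⟩ := S.exists_isPath u
    obtain ⟨q, -⟩ := S.exists_isPath v
    exact ⟨p.append q.reverse⟩
  refine SimpleGraph.isTree_iff_connected_and_card.2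
    ⟨hconn, le_antisymm ?_ hconn.card_vert_le_card_edgeSet_add_one⟩
  have hsub : S.graph.edgeSet ⊆
      ((Finset.univ.erase S.root).image fun v => s(v, S.parent v) : Finset (Sym2 V)) := by
    intro e
    induction e with
    | h u v =>
    have key : ∀ u v, u ≠ v → S.parent u = v →
        s(u, v) ∈ (Finset.univ.erase S.root).image fun v => s(v, S.parent v) := by
      rintro u v hne rfl
      refine Finset.mem_image.2 ⟨u, ?_, rfl⟩
      simp only [Finset.mem_erase, Finset.mem_univ, and_true]
      rintro rfl
      exact hne S.parent_root.symm
    intro h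
    obtain ⟨hne, h | h⟩ := S.adj_iff.1 ((SimpleGraph.mem_edgeSet _).1 h)
    · exact key u v hne h
    · rw [Sym2.eq_swap]
      exact key v u hne.symm h
  have h1 := Set.ncard_le_ncard hsub (Finset.finite_toSet _)
  rw [Set.ncard_coe_finset] at h1
  have h2 := Finset.card_image_le (s := Finset.univ.erase S.root) (f := fun v => s(v, S.parent v))
  rw [Finset.card_erase_of_mem (Finset.mem_univ _), Finset.card_univ] at h2
  have h3 : 0 < Fintype.card V := Fintype.card_pos_iff.2 ⟨S.root⟩
  rw [Nat.card_coe_set_eq, Nat.card_eq_fintype_card]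
  omega

/-- A maximal cluster around `x` strictly inside that of `v` has parent `v`, as otherwise its parent
would be a larger one. -/
theorem exists_child_mem [Finite V] {v : V} {x : X} (hx : x ∈ S.cl v) (hv : S.cl v ≠ {x}) :
    ∃ w, S.graph.Adj v w ∧ x ∈ S.cl w ∧ S.cl w ⊂ S.cl v := by
  obtain ⟨u, hu⟩ := S.exists_singleton x (S.cl_subset v hx)
  have hne : {w | x ∈ S.cl w ∧ S.cl w ⊂ S.cl v}.Nonempty :=
    ⟨u, by simp [hu], by rw [hu]; exact (Finset.singleton_subset_iff.2 hx).ssubset_of_ne hv.symm⟩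
  obtain ⟨w, ⟨hw1, hw2⟩, hmax⟩ := (Set.toFinite _).exists_maximalFor S.cl _ hne
  refine ⟨w, S.adj_iff.2 ⟨fun h => hw2.ne (h ▸ rfl), .inr ?_⟩, hw1, hw2⟩
  by_contra hc
  have h1 := S.parent_subset w v hw2
  have hwr : w ≠ S.root := by
    rintro rfl
    rw [S.cl_root] at hw2
    exact hw2.2 (S.cl_subset v)
  have h2 := S.ssubset_parent w hwr
  exact h2.2 (hmax (j := S.parent w) ⟨h2.1 hw1, h1.ssubset_of_ne fun h => hc (S.cl_injective h)⟩
    h2.1)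

theorem exists_two_children [Finite V] {v : V} (hv : (S.cl v).Nonempty)
    (hv' : ∀ x, S.cl v ≠ {x}) : ∃ w w', w ≠ w' ∧ S.graph.Adj v w ∧ S.graph.Adj v w' ∧
      S.cl w ⊂ S.cl v ∧ S.cl w' ⊂ S.cl v := by
  obtain ⟨x, hx⟩ := hv
  obtain ⟨w, h1, h2, h3⟩ := S.exists_child_mem hx (hv' x)
  obtain ⟨y, hy, hyw⟩ := Finset.exists_of_ssubset h3
  obtain ⟨w', h1', h2', h3'⟩ := S.exists_child_mem hy (hv' y)
  exact ⟨w, w', fun h => hyw (h ▸ h2'), h1, h1', h3, h3'⟩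

theorem degree_eq_one [Fintype V] [DecidableRel S.graph.Adj] {v : V} {x : X}
    (hv : S.cl v = {x}) : S.graph.degree v = 1 := by
  have hvr : v ≠ S.root := by
    rintro rfl
    exact S.ne_singleton x (S.cl_root ▸ hv)
  rw [SimpleGraph.degree_eq_one_iff_existsUnique_adj]
  refine ⟨S.parent v, S.adj_parent hvr, fun w hw => ?_⟩
  obtain ⟨hne, h | h⟩ := S.adj_iff.1 hw
  · exact h.symm
  · exfalso
    have hwr : w ≠ S.root := by
      rintro rfl
      exact hne (h ▸ S.parent_root)
    have h1 := S.ssubset_parent w hwr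
    rw [h, hv, Finset.ssubset_singleton_iff] at h1
    exact (S.cl_nonempty w hwr).ne_empty h1

theorem three_le_degree [Fintype V] [DecidableRel S.graph.Adj] {v : V} (hvr : v ≠ S.root)
    (hv' : ∀ x, S.cl v ≠ {x}) : 3 ≤ S.graph.degree v := by
  classical
  obtain ⟨w, w', hne, h1, h2, h3, h4⟩ := S.exists_two_children (S.cl_nonempty v hvr) hv'
  have h5 := S.ssubset_parent v hvr
  have hw : S.parent v ≠ w := fun h => (h5.trans (h ▸ h3)).2 subset_rfl
  have hw' : S.parent v ≠ w' := fun h => (h5.trans (h ▸ h4)).2 subset_rfl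
  rw [← SimpleGraph.card_neighborFinset_eq_degree]
  have : ({S.parent v, w, w'} : Finset V) ⊆ S.graph.neighborFinset v := by
    simp [Finset.insert_subset_iff, h1, h2, S.adj_parent hvr]
  refine le_trans ?_ (Finset.card_le_card this)
  rw [Finset.card_eq_three.2 ⟨_, _, _, hw, hw', hne, rfl⟩]

theorem degree_root_ne_one [Fintype V] [DecidableRel S.graph.Adj] :
    S.graph.degree S.root ≠ 1 := by
  intro h
  rw [SimpleGraph.degree_eq_one_iff_existsUnique_adj] at h
  obtain ⟨u, hu, huniq⟩ := h
  rcases S.L.eq_empty_or_nonempty with hL | hL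
  · refine (S.adj_iff.1 hu).1 (S.cl_injective ?_)
    rw [S.cl_root, hL, eq_comm, ← Finset.subset_empty, ← hL]
    exact S.cl_subset u
  · obtain ⟨w, w', hne, h1, h2, -⟩ := S.exists_two_children (v := S.root) (S.cl_root ▸ hL)
      (S.cl_root ▸ S.ne_singleton)
    exact hne ((huniq w h1).trans (huniq w' h2).symm)

theorem degree_eq_one_iff [Fintype V] [DecidableRel S.graph.Adj] {v : V} :
    S.graph.degree v = 1 ↔ ∃ x, S.cl v = {x} := by
  refine ⟨fun h => ?_, fun ⟨x, hx⟩ => S.degree_eq_one hx⟩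
  by_contra! hc
  by_cases hv : v = S.root
  · exact S.degree_root_ne_one (hv ▸ h)
  · have := S.three_le_degree hv hc
    omega

/-- The vertex whose cluster is the singleton of a given taxon. -/
noncomputable def leaf (x : (S.L : Set X)) : V := (S.exists_singleton x x.2).choose

theorem cl_leaf (x : (S.L : Set X)) : S.cl (S.leaf x) = {(x : X)} :=
  (S.exists_singleton x x.2).choose_spec

open Classical in
/-- The phylogenetic tree of a cluster system. -/
noncomputable def toPhyloTree [Fintype V] : PhyloTree X where
  V := V
  graph := S.graph
  isTree := S.isTree
  root := S.root
  root_inner := S.degree_root_ne_one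
  inner_degree v hv h := S.three_le_degree hv fun x hx => h (S.degree_eq_one hx)
  leafSet := S.L
  leaf := S.leaf
  leaf_injective x y h := by
    have := S.cl_leaf x
    rw [h, S.cl_leaf y, Finset.singleton_inj] at this
    exact Subtype.ext this.symm
  range_leaf := by
    ext v
    simp only [Set.mem_range, Set.mem_ofPred_eq, S.degree_eq_one_iff]
    constructor
    · rintro ⟨x, rfl⟩
      exact ⟨x, S.cl_leaf x⟩
    · rintro ⟨x, hx⟩
      have hxL : x ∈ S.L := S.cl_subset v (hx ▸ Finset.mem_singleton_self x)
      exact ⟨⟨x, hxL⟩, S.cl_injective ((S.cl_leaf _).trans hx.symm)⟩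

theorem cluster_toPhyloTree [Fintype V] (v : V) : S.toPhyloTree.cluster v = S.cl v := by
  have key : ∀ x : (S.L : Set X), v ∈ S.toPhyloTree.pathVertices (S.leaf x) S.root ↔
      (x : X) ∈ S.cl v := by
    intro x
    obtain ⟨q, hq, hqs⟩ := S.exists_isPath (S.leaf x)
    refine (S.toPhyloTree.mem_pathVertices (p := q) hq).trans ?_
    rw [← Finset.singleton_subset_iff, ← S.cl_leaf x]
    exact hqs v
  ext x
  constructor
  · rintro ⟨hx, h⟩
    exact (key ⟨x, hx⟩).1 h
  · intro h
    have hx : x ∈ S.L := S.cl_subset v h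
    exact ⟨hx, (key ⟨x, hx⟩).2 h⟩

/-- A laminar family of clusters containing `L` and all singletons is a cluster system. -/
theorem exists_of_laminar [Finite V] {L : Finset X} {cl : V → Finset X}
    (cl_injective : Function.Injective cl) {root : V} (cl_root : cl root = L)
    (cl_subset : ∀ v, cl v ⊆ L) (cl_nonempty : ∀ v, v ≠ root → (cl v).Nonempty)
    (exists_singleton : ∀ x ∈ L, ∃ v, cl v = {x}) (ne_singleton : ∀ x, L ≠ {x})
    (laminar : ∀ v w x, x ∈ cl v → x ∈ cl w → cl v ⊆ cl w ∨ cl w ⊆ cl v) :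
    ∃ S : ClusterSystem V X, S.L = L ∧ S.cl = cl := by
  have hroot : ∀ w, ¬ cl root ⊂ cl w := fun w h => h.2 (cl_root ▸ cl_subset w)
  have H : ∀ v, ∃ p, (v = root → p = root) ∧ (v ≠ root → cl v ⊂ cl p) ∧
      ∀ w, cl v ⊂ cl w → cl p ⊆ cl w := by
    intro v
    by_cases hv : v = root
    · subst hv
      exact ⟨v, fun _ => rfl, fun h => absurd rfl h, fun w hw => absurd hw (hroot w)⟩
    have hne : {w | cl v ⊂ cl w}.Nonempty :=
      ⟨root, (cl_root ▸ cl_subset v : cl v ⊆ cl root).ssubset_of_ne fun h => hv (cl_injective h)⟩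
    obtain ⟨p, hp, hmin⟩ := (Set.toFinite _).exists_minimalFor cl _ hne
    refine ⟨p, fun h => absurd h hv, fun _ => hp, fun w hw => ?_⟩
    obtain ⟨x, hx⟩ := cl_nonempty v hv
    rcases laminar p w x (hp.1 hx) (hw.1 hx) with h | h
    · exact h
    · exact hmin hw h
  choose p hp1 hp2 hp3 using H
  exact ⟨⟨L, cl, root, p, cl_injective, cl_root, cl_subset, cl_nonempty, exists_singleton,
    ne_singleton, hp1 root rfl, hp2, hp3⟩, rfl, rfl⟩

end ClusterSystem

/-- Every laminar family on a finite set of taxa is displayed by a phylogenetic tree. -/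
theorem IsLaminar.exists_phyloTree {F : Set (Set X)} (hF : IsLaminar F) {L : Set X}
    (hL : L.Finite) (hne : ∀ x, L ≠ {x}) : ∃ T : PhyloTree X, T.leafSet = L ∧
      ∀ a b c, a ≠ b → a ∈ L → b ∈ L → c ∈ L →
        (Separates T.clusters a b c ↔ Separates F a b c) := by
  classical
  lift L to Finset X using hL
  set H : Finset (Finset X) := L.powerset.filter fun D =>
    D = L ∨ (∃ x, D = {x}) ∨ (D.Nonempty ∧ ∃ C ∈ F, (D : Set X) = C ∩ L) with hH
  have hmem : ∀ D, D ∈ H ↔ D ⊆ L ∧ (D = L ∨ (∃ x, D = {x}) ∨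
      (D.Nonempty ∧ ∃ C ∈ F, (D : Set X) = C ∩ L)) := by simp [hH]
  -- Clusters are numbered because vertices must live in `Type`, whereas `X` lives in `Type u`.
  set cl : Fin H.card → Finset X := fun v => (H.equivFin.symm v).1 with hcl
  have hclH : ∀ v, cl v ∈ H := fun v => (H.equivFin.symm v).2
  have hsurj : ∀ D ∈ H, ∃ v, cl v = D := fun D hD => ⟨H.equivFin ⟨D, hD⟩, by simp [hcl]⟩
  obtain ⟨root, hroot⟩ := hsurj L ((hmem L).2 ⟨subset_rfl, .inl rfl⟩)
  have hinj : Function.Injective cl := Subtype.val_injective.comp H.equivFin.symm.injective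
  obtain ⟨S, hSL, hScl⟩ := ClusterSystem.exists_of_laminar hinj hroot
    (fun v => ((hmem _).1 (hclH v)).1)
    (fun v hv => by
      rcases ((hmem _).1 (hclH v)).2 with h | ⟨x, h⟩ | h
      · exact absurd (hinj (h.trans hroot.symm)) hv
      · simp [h]
      · exact h.1)
    (fun x hx => hsurj _ ((hmem _).2 ⟨by simpa using hx, .inr (.inl ⟨x, rfl⟩)⟩))
    (fun x h => hne x (by simp [h]))
    (fun v w x hx hx' => by
      obtain ⟨hv, hv'⟩ := (hmem _).1 (hclH v)
      obtain ⟨hw, hw'⟩ := (hmem _).1 (hclH w)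
      rcases hv' with h | ⟨y, h⟩ | ⟨-, C, hC, h⟩
      · exact .inr (h ▸ hw)
      · rw [h, Finset.mem_singleton] at hx
        rw [h, Finset.singleton_subset_iff, ← hx]
        exact .inl hx'
      rcases hw' with h' | ⟨y, h'⟩ | ⟨-, D, hD, h'⟩
      · exact .inl (h' ▸ hv)
      · rw [h', Finset.mem_singleton] at hx'
        rw [h', Finset.singleton_subset_iff, ← hx']
        exact .inr hx
      rw [← Finset.mem_coe, h] at hx
      rw [← Finset.mem_coe, h'] at hx'
      rw [← Finset.coe_subset, ← Finset.coe_subset, h, h']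
      exact (hF C hC D hD ⟨x, hx.1, hx'.1⟩).imp (Set.inter_subset_inter_left _)
        (Set.inter_subset_inter_left _))
  refine ⟨S.toPhyloTree, congrArg (fun l : Finset X => (l : Set X)) hSL,
    fun a b c hab ha hb hc => ⟨?_, ?_⟩⟩
  · rintro ⟨_, ⟨v, rfl⟩, h1, h2, h3⟩
    rw [S.cluster_toPhyloTree v, hScl, Finset.mem_coe] at h1 h2 h3
    rcases ((hmem _).1 (hclH v)).2 with h | ⟨y, h⟩ | ⟨-, C, hC, h⟩
    · exact absurd (h ▸ hc) h3
    -- The added singletons are why `a ≠ b` is required.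
    · rw [h, Finset.mem_singleton] at h1 h2
      exact absurd (h1.trans h2.symm) hab
    · rw [← Finset.mem_coe, h] at h1 h2 h3
      exact ⟨C, hC, h1.1, h2.1, fun h => h3 ⟨h, hc⟩⟩
  · rintro ⟨C, hC, h1, h2, h3⟩
    obtain ⟨v, hv⟩ := hsurj (L.filter (· ∈ C)) ((hmem _).2 ⟨Finset.filter_subset _ _, .inr (.inr
      ⟨⟨a, by simp_all⟩, C, hC, by ext; simp [and_comm]⟩)⟩)
    refine ⟨_, ⟨v, rfl⟩, ?_⟩
    rw [S.cluster_toPhyloTree v, hScl, hv]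
    simp_all

end ParentGraph

/-! ### Graph connectivity as a linear matroid -/

section Matroid

variable {α : Type*} {K W : Type*} [Field K] [AddCommGroup W] [Module K W]

/-- The minimal spanning subsets of a finite set of vectors are the bases of a matroid. -/
theorem exists_matroid_of_vectors (φ : α → W) {E : Set α} (hE : E.Finite) :
    ∃ M : Matroid α, M.E = E ∧ ∀ I, M.Indep I ↔ ∃ B,
      Minimal (fun S => S ⊆ E ∧ ∀ e ∈ E, φ e ∈ Submodule.span K (φ '' S)) B ∧ I ⊆ B := by
  refine ⟨(IndepMatroid.ofFinite hE (fun I => I ⊆ E ∧ LinearIndepOn K φ I)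
    ⟨Set.empty_subset _, linearIndepOn_empty K φ⟩ (fun I J hJ hIJ => ⟨hIJ.trans hJ.1, hJ.2.mono hIJ⟩)
    ?_ (fun I hI => hI.1)).matroid, rfl, fun I => ?_⟩
  · rintro I J ⟨hI, hI'⟩ ⟨hJ, hJ'⟩ hlt
    by_contra! hc
    have hspan : φ '' J ⊆ Submodule.span K (φ '' I) := by
      rintro _ ⟨e, he, rfl⟩
      by_cases heI : e ∈ I
      · exact Submodule.subset_span ⟨e, heI, rfl⟩
      · by_contra hs
        exact hc e he heI (Set.insert_subset (hJ he) hI) ((linearIndepOn_insert heI).2 ⟨hI', hs⟩)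
    have hfI : I.Finite := hE.subset hI
    have : Fintype (φ '' I) := (hfI.image φ).fintype
    -- If no element of `J` augments `I`, then `J` is independent in the span of `I`, so it cannot
    -- be larger.
    have h1 := linearIndependent_le_span' _ hJ' (φ '' I) (by
      rintro _ ⟨⟨e, he⟩, rfl⟩
      exact hspan ⟨e, he, rfl⟩)
    rw [← Set.cast_ncard (hE.subset hJ), Nat.cast_le, ← Nat.card_eq_fintype_card,
      Nat.card_coe_set_eq] at h1
    exact absurd (h1.trans (Set.ncard_image_le hfI)) (not_le.2 hlt)
  · simp only [IndepMatroid.matroid_indep_iff, IndepMatroid.ofFinite_indep]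
    constructor
    · rintro ⟨hI, hI'⟩
      obtain ⟨B, hBE, hIB, hsp, hB⟩ := exists_linearIndepOn_extension hI' hI
      refine ⟨B, ⟨⟨hBE, fun e he => hsp ⟨e, he, rfl⟩⟩, fun S hS hSB e he => ?_⟩, hIB⟩
      by_contra heS
      refine linearIndepOn_iff_notMem_span.1 hB e he (Submodule.span_mono ?_ (hS.2 e (hBE he)))
      exact Set.image_mono fun x hx => ⟨hSB hx, fun h => heS (h ▸ hx)⟩
    · rintro ⟨B, ⟨⟨hBE, hB⟩, hmin⟩, hIB⟩
      refine ⟨hIB.trans hBE, LinearIndepOn.mono (linearIndepOn_iff_notMem_span.2 ?_) hIB⟩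
      intro e he hs
      have hspan : φ '' B ⊆ Submodule.span K (φ '' (B \ {e})) := by
        rintro _ ⟨x, hx, rfl⟩
        by_cases hxe : x = e
        · exact hxe ▸ hs
        · exact Submodule.subset_span ⟨x, ⟨hx, hxe⟩, rfl⟩
      exact (hmin (y := B \ {e}) ⟨Set.sdiff_subset.trans hBE,
        fun x hx => Submodule.span_le.2 hspan (hB x hx)⟩ Set.sdiff_subset he).2 rfl

/-- Connectivity in a graph in terms of the incidence vectors of its edges. -/
theorem mem_span_edgeVectors_iff {N : Type*} (r : N → N → Prop) (f g : α → N) (S : Set α)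
    (x y : N) : Finsupp.single (Quot.mk r x) (1 : ℚ) - Finsupp.single (Quot.mk r y) 1 ∈
        Submodule.span ℚ ((fun s => Finsupp.single (Quot.mk r (f s)) (1 : ℚ) -
          Finsupp.single (Quot.mk r (g s)) 1) '' S) ↔
      Relation.EqvGen (fun u v => r u v ∨ ∃ s ∈ S, u = f s ∧ v = g s) x y := by
  classical
  constructor
  · intro h
    set R := Relation.EqvGen (fun u v => r u v ∨ ∃ s ∈ S, u = f s ∧ v = g s) with hR
    have hinv : ∀ u v, R u v → (R x u ↔ R x v) := fun u v huv =>
      ⟨fun h => h.trans _ _ _ huv, fun h => h.trans _ _ _ (huv.symm _ _)⟩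
    -- The indicator of the component of `x` extends to a functional that kills every edge vector,
    -- but takes the value 1 on the given difference if `y` lies elsewhere. The quotient contracts
    -- the edges of `r`.
    let w : Quot r → ℚ := Quot.lift (fun u => if R x u then 1 else 0) fun u v huv => by
      simp only [hinv u v (.rel _ _ (.inl huv))]
    let ℓ : (Quot r →₀ ℚ) →ₗ[ℚ] ℚ := Finsupp.linearCombination ℚ w
    have hℓ : Submodule.span ℚ ((fun s => Finsupp.single (Quot.mk r (f s)) (1 : ℚ) -
          Finsupp.single (Quot.mk r (g s)) 1) '' S) ≤ LinearMap.ker ℓ := by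
      rw [Submodule.span_le]
      rintro _ ⟨s, hs, rfl⟩
      simp [ℓ, w, hinv (f s) (g s) (.rel _ _ (.inr ⟨s, hs, rfl, rfl⟩))]
    have := hℓ h
    by_contra hxy
    have hxx : R x x := .refl x
    simp [ℓ, w, hxx, hxy] at this
  · intro h
    induction h with
    | rel u v h =>
      rcases h with h | ⟨s, hs, rfl, rfl⟩
      · simp [Quot.sound h]
      · exact Submodule.subset_span ⟨s, hs, rfl⟩
    | refl u => simp
    | symm u v _ ih => rw [← neg_sub]; exact Submodule.neg_mem _ ih
    | trans u v w _ _ ih1 ih2 =>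
      have := Submodule.add_mem _ ih1 ih2
      rwa [sub_add_sub_cancel] at this

/-- In a graph with edges `r` and `(f e, g e)` for `e ∈ E`, the minimal sets of edges from `E`
that, together with `r`, connect the ends of all edges are the bases of a matroid. -/
theorem exists_matroid_of_connectivity {N : Type*} (r : N → N → Prop) (f g : α → N) {E : Set α}
    (hE : E.Finite) : ∃ M : Matroid α, M.E = E ∧ ∀ I, M.Indep I ↔ ∃ B,
      Minimal (fun S => S ⊆ E ∧ ∀ e ∈ E,
        Relation.EqvGen (fun u v => r u v ∨ ∃ s ∈ S, u = f s ∧ v = g s) (f e) (g e)) B ∧ I ⊆ B := by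
  obtain ⟨M, hM, hI⟩ := exists_matroid_of_vectors (K := ℚ)
    (fun s => Finsupp.single (Quot.mk r (f s)) (1 : ℚ) - Finsupp.single (Quot.mk r (g s)) 1) hE
  refine ⟨M, hM, fun I => ?_⟩
  rw [hI]
  simp only [mem_span_edgeVectors_iff]

end Matroid

/-! ### The graph on ordered pairs of taxa -/

/-- The laws of the ternary relation of the triples displayed by all members of a set of trees. -/
structure IsTripleClosed {X : Type u} (C : X → X → X → Prop) : Prop where
  symm : ∀ {a b c}, C a b c → C b a c
  ne : ∀ {a b c}, C a b c → a ≠ b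
  ne_out : ∀ {a b c}, C a b c → a ≠ c
  asymm : ∀ {a b c}, C a b c → ¬ C a c b
  trans_out : ∀ {a b c d}, C a b c → C b c d → C a b d
  trans_in : ∀ {a b c d}, C a b c → C a d c → b = d ∨ C b d c
  cross : ∀ {a b c d}, C a b c → C c d a → C a b d

section PairGraph

variable {X : Type u} {C ρ : X → X → X → Prop} {a b c x y z w : X}

/-- The vertices below the child, towards `a`, of the last common ancestor of `a` and `c`. -/
def side (C : X → X → X → Prop) (a c : X) : Set X := {x | x = a ∨ C a x c}

/-- The ordered pairs `(x, z)` and `(a, c)` branch at the same vertex, in the same direction. -/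
def SamePair (C : X → X → X → Prop) (p q : X × X) : Prop :=
  p.1 ∈ side C q.1 q.2 ∧ p.2 ∈ side C q.2 q.1

/-- The adjacency of ordered pairs that depends only on the closure `C`. -/
def BaseAdj (C : X → X → X → Prop) (p q : X × X) : Prop :=
  (p.1 = q.1 ∧ C p.2 q.2 p.1) ∨ (p.2 = q.2 ∧ ∃ w, C p.1 q.1 w ∧ C q.1 w p.2)

/-- The adjacency of ordered pairs given by the triples `ρ` over the closure `C`. -/
def PairAdj (C ρ : X → X → X → Prop) (p q : X × X) : Prop :=
  BaseAdj C p q ∨ (p.2 = q.2 ∧ ρ p.1 q.1 p.2)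

namespace IsTripleClosed

theorem samePair_refl (p : X × X) : SamePair C p p := ⟨.inl rfl, .inl rfl⟩

theorem samePair_symm (hC : IsTripleClosed C) {p q : X × X} (h : SamePair C p q) :
    SamePair C q p := by
  obtain ⟨x, z⟩ := p
  obtain ⟨a, c⟩ := q
  obtain ⟨h1, h2⟩ := h
  have key : ∀ {x z a c}, (x = a ∨ C a x c) → (z = c ∨ C c z a) → (a = x ∨ C x a z) := by
    rintro x z a c (rfl | h1) h2
    · exact .inl rfl
    · rcases h2 with rfl | h2
      · exact .inr (hC.symm h1)
      · exact .inr (hC.symm (hC.cross h1 h2))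
  exact ⟨key h1 h2, key h2 h1⟩

theorem samePair_trans (hC : IsTripleClosed C) {p q r : X × X} (h : SamePair C p q)
    (h' : SamePair C q r) :
    SamePair C p r := by
  obtain ⟨u, w⟩ := p
  obtain ⟨h3, h4⟩ := hC.samePair_symm h'
  obtain ⟨x, z⟩ := q
  obtain ⟨a, c⟩ := r
  obtain ⟨h1, h2⟩ := h
  have key : ∀ {u x z a c}, (u = x ∨ C x u z) → (a = x ∨ C x a z) → (c = z ∨ C z c x) →
      (u = a ∨ C a u c) := by
    intro u x z a c h1 h3 h4
    have cc : ∀ {v}, C x v z → C x v c := by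
      intro v hv
      rcases h4 with rfl | h4
      · exact hv
      · exact hC.cross hv h4
    rcases h1 with rfl | h1 <;> rcases h3 with rfl | h3
    · exact .inl rfl
    · exact .inr (hC.symm (cc h3))
    · exact .inr (cc h1)
    · exact (hC.trans_in (cc h1) (cc h3)).imp id hC.symm
  exact ⟨key h1 h3 h4, key h2 h4 h3⟩

theorem samePair_of_pairAdj (hC : IsTripleClosed C) (hρ : ∀ a b c, ρ a b c → C a b c) {p q : X × X}
    (h : PairAdj C ρ p q) : SamePair C p q := by
  obtain ⟨x, z⟩ := p
  obtain ⟨y, z'⟩ := q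
  obtain (⟨rfl, h⟩ | ⟨rfl, w, h1, h2⟩) | ⟨rfl, h⟩ := h
  · exact ⟨.inl rfl, .inr (hC.symm h)⟩
  · exact ⟨.inr (hC.symm (hC.trans_out h1 h2)), .inl rfl⟩
  · exact ⟨.inr (hC.symm (hρ _ _ _ h)), .inl rfl⟩

/-- `SamePair` is an equivalence containing all edges, so paths stay at the branching where they
start. -/
theorem samePair_of_eqvGen (hC : IsTripleClosed C) (hρ : ∀ a b c, ρ a b c → C a b c) {p q : X × X}
    (h : Relation.EqvGen (PairAdj C ρ) p q) : SamePair C p q := by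
  induction h with
  | rel p q h => exact hC.samePair_of_pairAdj hρ h
  | refl p => exact samePair_refl p
  | symm p q _ ih => exact hC.samePair_symm ih
  | trans p q r _ _ ih1 ih2 => exact hC.samePair_trans ih1 ih2

/-- If `C` consists of triples inferred from `ρ`, the pairs of each triple of `C` are connected. -/
theorem eqvGen_of_inferred (hC : IsTripleClosed C) (hρ : ∀ a b c, ρ a b c → C a b c) {L : Set X}
    (hinf : ∀ a b c, a ≠ b → Inferred ρ L a b c → C a b c) (h : Inferred ρ L a b c) :
    Relation.EqvGen (PairAdj C ρ) (a, c) (b, c) := by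
  obtain ⟨L', hL, ha, hb, hc, hab, hall⟩ := h
  -- The same `L'` witnesses the inference for any two taxa of one component and one of the other.
  have inA : ∀ x y, AhoConn ρ L' x a → AhoConn ρ L' y a → x ≠ y → C x y c := by
    intro x y hx hy hne
    refine hinf x y c hne ⟨L', hL, hx.mem_left_iff.2 ha, hy.mem_left_iff.2 ha, hc,
      hx.trans hy.symm, fun v hv => (hall v hv).imp (fun h => h.trans hx.symm) id⟩
  have inC : ∀ z x, AhoConn ρ L' z c → AhoConn ρ L' x a → z ≠ c → C z c x := by
    intro z x hz hx hne
    refine hinf z c x hne ⟨L', hL, hz.mem_left_iff.2 hc, hc, hx.mem_left_iff.2 ha,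
      hz, fun v hv => ((hall v hv).imp (fun h => h.trans hx.symm)
        fun h => h.trans hz.symm).symm⟩
  have key : ∀ x y, AhoConn ρ L' x y → AhoConn ρ L' x a →
      Relation.EqvGen (PairAdj C ρ) (x, c) (y, c) := by
    intro x y h
    induction h with
    | rel x y h =>
      intro hx
      have hy : AhoConn ρ L' y a := (AhoConn.of_adj h).symm.trans hx
      obtain ⟨-, -, z, hz, hr⟩ := h
      have hCr := hρ _ _ _ hr
      -- If `z` is on the side of `a`, the Aho edge lifts to a base edge. If it is on the side of
      -- `c`, replace `c` by `z` through a base edge, use the edge of `ρ`, and return to `c`.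
      rcases hall z hz with hza | hzc
      · exact .rel _ _ (.inl (.inr ⟨rfl, z, hCr, inA y z hy hza (hC.ne_out (hC.symm hCr))⟩))
      · have hzx : ∀ v, AhoConn ρ L' v a → Relation.EqvGen (PairAdj C ρ) (v, z) (v, c) := by
          intro v hv
          by_cases hne : z = c
          · subst hne; exact .refl _
          · exact .rel _ _ (.inl (.inl ⟨rfl, inC z v hzc hv hne⟩))
        exact .trans _ _ _ ((hzx x hx).symm _ _) 
          (.trans _ _ _ (.rel (x, z) (y, z) (.inr ⟨rfl, hr⟩)) (hzx y hy))
    | refl x => exact fun _ => .refl _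
    | symm x y hxy ih => exact fun hy => (ih (AhoConn.trans hxy hy)).symm _ _
    | trans x y z hxy _ ih1 ih2 =>
      exact fun hx => (ih1 hx).trans _ _ _ (ih2 (AhoConn.trans (AhoConn.symm hxy) hx))
  exact key a b hab (.refl a)

theorem side_eq (hC : IsTripleClosed C) {p q : X × X} (h : SamePair C p q) :
    side C p.1 p.2 = side C q.1 q.2 := by
  have key : ∀ {p q : X × X}, SamePair C p q → side C p.1 p.2 ⊆ side C q.1 q.2 := by
    intro p q h x hx
    exact (hC.samePair_trans (p := (x, p.2)) ⟨hx, .inl rfl⟩ h).1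
  exact (key h).antisymm (key (hC.samePair_symm h))

theorem side_eq_swap (hC : IsTripleClosed C) {p q : X × X} (h : SamePair C p q) :
    side C p.2 p.1 = side C q.2 q.1 :=
  hC.side_eq (p := p.swap) (q := q.swap) ⟨h.2, h.1⟩

/-- A branching below a branching has its taxa on one side of the latter. -/
theorem side_union_ssubset (hC : IsTripleClosed C) (h1 : C x y w) (h2 : C y w z) :
    side C x w ∪ side C w x ⊂ side C x z ∪ side C z x := by
  have hxyz : C x y z := hC.trans_out h1 h2
  have hxwz : C x w z :=
    (hC.trans_in (hC.symm hxyz) h2).resolve_left (hC.ne_out h1)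
  have hwxz : C w x z := hC.symm hxwz
  have hz : z ∈ side C x z ∪ side C z x := .inr (.inl rfl)
  refine ⟨?_, fun hsub => ?_⟩
  · rintro u (hu | hu)
    · left
      rcases hu with rfl | hu
      · exact .inl rfl
      · exact .inr (hC.symm (hC.trans_out (hC.symm hu) hxwz))
    · left
      rcases hu with rfl | hu
      · exact .inr hxwz
      · have h3 : C w u z := hC.symm (hC.trans_out (hC.symm hu) hwxz)
        exact (hC.trans_in h3 hwxz).imp id hC.symm
  · rcases hsub hz with (rfl | h) | (rfl | h)
    · exact hC.ne_out hxyz rfl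
    · exact hC.asymm h hxwz
    · exact hC.ne_out hwxz rfl
    · exact hC.asymm h hwxz

/-- If the pairs of each triple of `C` are connected, then the triples of `ρ` connect both sides
of each branching of `C` in the Aho graph. -/
theorem ahoConn_of_eqvGen (hC : IsTripleClosed C) (hρ : ∀ a b c, ρ a b c → C a b c)
    {L : Set X} (hL : L.Finite)
    (hCL : ∀ a b c, C a b c → a ∈ L ∧ b ∈ L ∧ c ∈ L)
    (h : ∀ a b c, C a b c → Relation.EqvGen (PairAdj C ρ) (a, c) (b, c)) (habc : C a b c) :
    AhoConn ρ (side C a c ∪ side C c a) a b := by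
  induction hn : (side C a c ∪ side C c a).ncard using Nat.strong_induction_on
    generalizing a b c with
  | _ n ih =>
  have hfin : (side C a c ∪ side C c a).Finite := hL.subset (by
    rintro u ((rfl | h) | (rfl | h))
    · exact (hCL _ _ _ habc).1
    · exact (hCL _ _ _ h).2.1
    · exact (hCL _ _ _ habc).2.2
    · exact (hCL _ _ _ h).2.1)
  have key : ∀ p q, Relation.EqvGen (PairAdj C ρ) p q → SamePair C p (a, c) →
      AhoConn ρ (side C a c ∪ side C c a) p.1 q.1 := by
    intro p q hpq
    induction hpq with
    | rel p q hpq =>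
      intro hp
      have hq := hC.samePair_trans (hC.samePair_symm (hC.samePair_of_pairAdj hρ hpq)) hp
      obtain ⟨x, z⟩ := p
      obtain ⟨y, z'⟩ := q
      -- A base edge changing the second coordinate projects to a point. One changing the first
      -- involves a branching strictly below, covered by induction. An edge of `ρ` is an Aho edge,
      -- its third taxon being on the opposite side.
      obtain (⟨rfl, -⟩ | ⟨rfl, w, h1, h2⟩) | ⟨rfl, hr⟩ := hpq
      · exact .refl _
      · have hss := hC.side_union_ssubset h1 h2
        have e1 := hC.side_eq hp
        have e2 := hC.side_eq_swap hp
        dsimp only at h1 h2 hss e1 e2 ⊢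
        rw [e1, e2] at hss
        exact (ih _ (hn ▸ Set.ncard_lt_ncard hss hfin) h1 rfl).mono hss.1
      · exact .of_adj ⟨.inl hp.1, .inl hq.1, z, .inr hp.2, hr⟩
    | refl p => exact fun _ => .refl _
    | symm p q hpq ih =>
      exact fun hq => (ih (hC.samePair_trans (hC.samePair_of_eqvGen hρ hpq) hq)).symm
    | trans p q r hpq _ ih1 ih2 =>
      exact fun hp => (ih1 hp).trans
        (ih2 (hC.samePair_trans (hC.samePair_symm (hC.samePair_of_eqvGen hρ hpq)) hp))
  exact key _ _ (h a b c habc) (samePair_refl _)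

/-- The witness is the union of the two sides of the branching, each of which is connected in its
Aho graph. -/
theorem inferred_of_eqvGen (hC : IsTripleClosed C) (hρ : ∀ a b c, ρ a b c → C a b c)
    {L : Set X} (hL : L.Finite)
    (hCL : ∀ a b c, C a b c → a ∈ L ∧ b ∈ L ∧ c ∈ L)
    (h : ∀ a b c, C a b c → Relation.EqvGen (PairAdj C ρ) (a, c) (b, c)) (habc : C a b c) :
    Inferred ρ L a b c := by
  refine ⟨side C a c ∪ side C c a, ?_, .inl (.inl rfl), .inl (.inr habc), .inr (.inl rfl),
    hC.ahoConn_of_eqvGen hρ hL hCL h habc, ?_⟩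
  · rintro u ((rfl | h) | (rfl | h))
    · exact (hCL _ _ _ habc).1
    · exact (hCL _ _ _ h).2.1
    · exact (hCL _ _ _ habc).2.2
    · exact (hCL _ _ _ h).2.1
  · rintro u ((rfl | hu) | (rfl | hu))
    · exact .inl (.refl _)
    · exact .inl (hC.ahoConn_of_eqvGen hρ hL hCL h hu).symm
    · exact .inr (.refl _)
    · have := hC.ahoConn_of_eqvGen hρ hL hCL h hu
      rw [Set.union_comm] at this
      exact .inr this.symm

end IsTripleClosed

end PairGraph

/-! ### Closures of triple sets and the theorem -/

theorem eqvGen_of_forall {N : Type*} {r s : N → N → Prop}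
    (h : ∀ x y, r x y → Relation.EqvGen s x y) {x y : N} (hxy : Relation.EqvGen r x y) :
    Relation.EqvGen s x y := by
  induction hxy with
  | rel x y hxy => exact h x y hxy
  | refl x => exact .refl x
  | symm x y _ ih => exact ih.symm
  | trans x y z _ _ ih1 ih2 => exact ih1.trans _ _ _ ih2

namespace RootedTriple

variable {X : Type u} {t : RootedTriple X} {a b : X}

theorem exists_pair_eq (t : RootedTriple X) : ∃ a b, t.pair = s(a, b) :=
  t.pair.ind fun a b => ⟨a, b, rfl⟩

theorem ne_of_pair_eq (h : t.pair = s(a, b)) : a ≠ b := by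
  have := t.pair_not_diag
  rwa [h, Sym2.mk_isDiag_iff] at this

theorem leaves_subset_iff (h : t.pair = s(a, b)) {L : Set X} :
    t.leaves ⊆ L ↔ a ∈ L ∧ b ∈ L ∧ t.out ∈ L := by
  constructor
  · intro hL
    exact ⟨hL (.inl (by simp [h])), hL (.inl (by simp [h])), hL (.inr rfl)⟩
  · rintro ⟨h1, h2, h3⟩ x (hx | rfl)
    · rw [h, Sym2.mem_iff] at hx
      rcases hx with rfl | rfl <;> assumption
    · exact h3

theorem finite_leaves (t : RootedTriple X) : t.leaves.Finite := by
  obtain ⟨a, b, h⟩ := t.exists_pair_eq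
  exact (Set.toFinite {a, b, t.out}).subset ((leaves_subset_iff h).2 (by simp))

end RootedTriple

theorem PhyloTree.mem_triples_iff_of_pair_eq {X : Type u} (T : PhyloTree X) {t : RootedTriple X}
    {a b : X} (h : t.pair = s(a, b)) : t ∈ T.triples ↔
      t.leaves ⊆ T.leafSet ∧ Separates T.clusters a b t.out := by
  rw [T.mem_triples_iff]
  refine and_congr_right fun _ => ⟨fun h' => h' a b h, fun h' a' b' h'' => ?_⟩
  rw [h, Sym2.eq_iff] at h''
  rcases h'' with ⟨rfl, rfl⟩ | ⟨rfl, rfl⟩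
  · exact h'
  · exact h'.symm

namespace TripleSet

variable {X : Type u} {R S : Set (RootedTriple X)} {a b c x y z : X}

/-- The ternary relation given by a set of triples. -/
def rel (S : Set (RootedTriple X)) (a b c : X) : Prop :=
  ∃ t ∈ S, t.pair = s(a, b) ∧ t.out = c

theorem rel.mono (h : S ⊆ R) : rel S a b c → rel R a b c := by
  rintro ⟨t, ht, h'⟩
  exact ⟨t, h ht, h'⟩

theorem rel.mem_leafSet (h : rel S a b c) : a ∈ leafSet S ∧ b ∈ leafSet S ∧ c ∈ leafSet S := by
  obtain ⟨t, ht, h1, rfl⟩ := h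
  exact (RootedTriple.leaves_subset_iff h1).1
    (Set.subset_biUnion_of_mem (u := fun t => t.leaves) ht)

theorem leafSet_mono (h : S ⊆ R) : leafSet S ⊆ leafSet R := Set.biUnion_subset_biUnion_left h

theorem finite_leafSet (h : S.Finite) : (leafSet S).Finite :=
  h.biUnion fun t _ => t.finite_leaves

theorem leafSet_ne_singleton (S : Set (RootedTriple X)) (x : X) : leafSet S ≠ {x} := by
  intro h
  obtain ⟨t, ht, -⟩ := Set.mem_iUnion₂.1 (h ▸ rfl : x ∈ leafSet S)
  obtain ⟨a, b, hab⟩ := t.exists_pair_eq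
  obtain ⟨h1, h2, -⟩ := rel.mem_leafSet ⟨t, ht, hab, rfl⟩
  rw [h] at h1 h2
  exact t.ne_of_pair_eq hab (h1.trans h2.symm)

theorem separates_of_rel {T : PhyloTree X} (h : S ⊆ T.triples) (hr : rel S a b c) :
    Separates T.clusters a b c := by
  obtain ⟨t, ht, h1, rfl⟩ := hr
  exact ((T.mem_triples_iff_of_pair_eq h1).1 (h ht)).2

/-- A laminar family displaying `S` yields a tree in the span of `S`. -/
theorem exists_mem_span (hS : S.Finite) {F : Set (Set X)} (hF : IsLaminar F)
    (h : ∀ a b c, rel S a b c → Separates F a b c) : ∃ T ∈ span S,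
      ∀ a b c, a ≠ b → a ∈ leafSet S → b ∈ leafSet S → c ∈ leafSet S →
        (Separates T.clusters a b c ↔ Separates F a b c) := by
  obtain ⟨T, hT, hsep⟩ := hF.exists_phyloTree (finite_leafSet hS) (leafSet_ne_singleton S)
  refine ⟨T, ⟨hT, fun t ht => ?_⟩, hsep⟩
  obtain ⟨a, b, hab⟩ := t.exists_pair_eq
  have hr : rel S a b t.out := ⟨t, ht, hab, rfl⟩
  obtain ⟨h1, h2, h3⟩ := hr.mem_leafSet
  rw [T.mem_triples_iff_of_pair_eq hab, RootedTriple.leaves_subset_iff hab, hT]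
  exact ⟨⟨h1, h2, h3⟩, (hsep a b _ (t.ne_of_pair_eq hab) h1 h2 h3).2 (h _ _ _ hr)⟩

theorem mem_leafSet_of_ahoConn {L : Set X} (h : AhoConn (rel S) L x y) (hne : x ≠ y) :
    x ∈ leafSet S := by
  rcases h.eq_or_exists with h | ⟨z, ⟨-, -, w, -, h⟩ | ⟨-, -, w, -, h⟩⟩
  · exact absurd h hne
  · exact h.mem_leafSet.1
  · exact h.mem_leafSet.2.1

/-- A taxon `c` outside `leafSet S` would be isolated. Deleting it leaves only the component of `a`,
so the triple with `c := a` would be inferred, and some cluster would both contain and miss `a`.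
Hence the ambient `L` may exceed `leafSet S`, which matters when `cl S` and `cl R` are compared. -/
theorem mem_leafSet_of_inferred {T : PhyloTree X} (hT : S ⊆ T.triples) (hab : a ≠ b) {L : Set X}
    (h : Inferred (rel S) L a b c) : a ∈ leafSet S ∧ b ∈ leafSet S ∧ c ∈ leafSet S := by
  obtain ⟨L', hL, ha, hb, hc, hconn, hall⟩ := h
  have haS := mem_leafSet_of_ahoConn hconn hab
  have hbS := mem_leafSet_of_ahoConn hconn.symm hab.symm
  refine ⟨haS, hbS, ?_⟩
  by_contra hcS
  have hne : ∀ {v}, v ∈ leafSet S → v ≠ c := fun hv h => hcS (h ▸ hv)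
  have key : ∀ {u v}, AhoConn (rel S) L' u v → AhoConn (rel S) (L' \ {c}) u v := by
    refine fun h => Relation.EqvGen.mono ?_ _ _ h
    rintro u v ⟨hu, hv, w, hw, hr⟩
    obtain ⟨h1, h2, h3⟩ := hr.mem_leafSet
    exact ⟨⟨hu, hne h1⟩, ⟨hv, hne h2⟩, w, ⟨hw, hne h3⟩, hr⟩
  refine (Inferred.separates (F := T.clusters) (L₀ := Set.univ) T.finite_clusters
    T.isLaminar_clusters (fun _ _ _ => separates_of_rel hT) hab (c := a)
    ⟨L' \ {c}, Set.subset_univ _, ⟨ha, hne haS⟩, ⟨hb, hne hbS⟩, ⟨ha, hne haS⟩, key hconn, ?_⟩).ne_left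
    rfl
  rintro v ⟨hv, hvc⟩
  rcases hall v hv with h | h
  · exact .inl (key h)
  · exact absurd (mem_leafSet_of_ahoConn h.symm (Ne.symm hvc)) hcS

/-- The closure of a consistent set of triples consists of the inferred triples. -/
theorem mem_cl_iff (hS : S.Finite) {T₀ : PhyloTree X} (hT₀ : S ⊆ T₀.triples) {L : Set X}
    (hL : leafSet S ⊆ L) {t : RootedTriple X} (ht : t.pair = s(a, b)) :
    t ∈ cl S ↔ Inferred (rel S) L a b t.out := by
  have hab := t.ne_of_pair_eq ht
  constructor
  · intro h
    have h' : ∀ T ∈ span S, t ∈ T.triples := fun T hT => Set.mem_iInter₂.1 h T hT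
    -- The span must be nonempty: an empty intersection would contain all triples.
    obtain ⟨T₁, hT₁, -⟩ := exists_mem_span hS T₀.isLaminar_clusters
      (fun _ _ _ => separates_of_rel hT₀)
    have hleaves := ((T₁.mem_triples_iff_of_pair_eq ht).1 (h' T₁ hT₁)).1
    rw [hT₁.1, RootedTriple.leaves_subset_iff ht] at hleaves
    obtain ⟨ha, hb, hc⟩ := hleaves
    refine Inferred.mono hL ?_
    by_contra hi
    obtain ⟨H, hH, hHS, hHt⟩ := exists_laminar_of_not_inferred T₀.isLaminar_clusters
      (fun _ _ _ => separates_of_rel hT₀) (leafSet S) (finite_leafSet hS) ha hb hc hi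
    obtain ⟨T₂, hT₂, hsep⟩ := exists_mem_span hS hH (fun x y z hr =>
      hHS x y z hr.mem_leafSet.1 hr.mem_leafSet.2.1 hr.mem_leafSet.2.2 hr)
    exact hHt ((hsep a b _ hab ha hb hc).1 ((T₂.mem_triples_iff_of_pair_eq ht).1 (h' T₂ hT₂)).2)
  · intro h
    refine Set.mem_iInter₂.2 fun T hT => ?_
    rw [T.mem_triples_iff_of_pair_eq ht, RootedTriple.leaves_subset_iff ht, hT.1]
    exact ⟨mem_leafSet_of_inferred hT₀ hab h, h.separates T.finite_clusters T.isLaminar_clusters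
      (fun _ _ _ => separates_of_rel hT.2) hab⟩

theorem rel_cl_iff (hR : R.Finite) {T₀ : PhyloTree X} (hT₀ : R ⊆ T₀.triples) :
    rel (cl R) a b c ↔ a ≠ b ∧ a ∈ leafSet R ∧ b ∈ leafSet R ∧ c ∈ leafSet R ∧
      ∀ T ∈ span R, Separates T.clusters a b c := by
  obtain ⟨T₁, hT₁, -⟩ := exists_mem_span hR T₀.isLaminar_clusters
    (fun _ _ _ => separates_of_rel hT₀)
  constructor
  · rintro ⟨t, ht, h, rfl⟩
    have h' : ∀ T ∈ span R, t ∈ T.triples := fun T hT => Set.mem_iInter₂.1 ht T hT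
    have hl := ((T₁.mem_triples_iff_of_pair_eq h).1 (h' T₁ hT₁)).1
    rw [hT₁.1, RootedTriple.leaves_subset_iff h] at hl
    exact ⟨t.ne_of_pair_eq h, hl.1, hl.2.1, hl.2.2, fun T hT =>
      ((T.mem_triples_iff_of_pair_eq h).1 (h' T hT)).2⟩
  · rintro ⟨hab, ha, hb, hc, h⟩
    have hac := (h T₁ hT₁).ne_left
    have hbc := (h T₁ hT₁).symm.ne_left
    refine ⟨⟨s(a, b), c, by simpa using hab, by simp [hac.symm, hbc.symm]⟩, ?_, rfl, rfl⟩
    refine Set.mem_iInter₂.2 fun T hT => ?_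
    rw [T.mem_triples_iff_of_pair_eq rfl, RootedTriple.leaves_subset_iff rfl, hT.1]
    exact ⟨⟨ha, hb, hc⟩, h T hT⟩

/-- Each law holds in every single tree by laminarity and passes to the intersection; `asymm` and
`ne_out` need one tree in the span. -/
theorem isTripleClosed_cl (hR : R.Finite) {T₀ : PhyloTree X} (hT₀ : R ⊆ T₀.triples) :
    IsTripleClosed (rel (cl R)) := by
  obtain ⟨T₁, hT₁, -⟩ := exists_mem_span hR T₀.isLaminar_clusters
    (fun _ _ _ => separates_of_rel hT₀)
  refine ⟨?_, ?_, ?_, ?_, ?_, ?_, ?_⟩ <;> simp only [rel_cl_iff hR hT₀]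
  · rintro a b c ⟨h1, h2, h3, h4, h⟩
    exact ⟨h1.symm, h3, h2, h4, fun T hT => (h T hT).symm⟩
  · exact fun {a b c} h => h.1
  · exact fun {a b c} h => (h.2.2.2.2 T₁ hT₁).ne_left
  · rintro a b c ⟨-, -, -, -, h⟩ ⟨-, -, -, -, h'⟩
    exact (h T₁ hT₁).asymm T₁.isLaminar_clusters (h' T₁ hT₁)
  · rintro a b c d ⟨h1, h2, h3, h4, h⟩ ⟨h1', h2', h3', h4', h'⟩
    exact ⟨h1, h2, h3, h4', fun T hT => (h T hT).trans_out T.isLaminar_clusters (h' T hT)⟩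
  · rintro a b c d ⟨h1, h2, h3, h4, h⟩ ⟨h1', h2', h3', h4', h'⟩
    by_cases hbd : b = d
    · exact .inl hbd
    · exact .inr ⟨hbd, h3, h3', h4, fun T hT => (h T hT).trans_in T.isLaminar_clusters (h' T hT)⟩
  · rintro a b c d ⟨h1, h2, h3, h4, h⟩ ⟨h1', h2', h3', h4', h'⟩
    exact ⟨h1, h2, h3, h3', fun T hT => (h T hT).cross T.isLaminar_clusters (h' T hT)⟩

theorem subset_cl (R : Set (RootedTriple X)) : R ⊆ cl R :=
  fun _ ht => Set.mem_iInter₂.2 fun _ hT => hT.2 ht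

/-- A subset of `R` is representative if and only if it connects the pairs of each triple of
`R`. -/
theorem cl_eq_iff (hR : R.Finite) {T₀ : PhyloTree X} (hT₀ : R ⊆ T₀.triples) (hSR : S ⊆ R) :
    cl S = cl R ↔ ∀ a b c, rel R a b c →
      Relation.EqvGen (PairAdj (rel (cl R)) (rel S)) (a, c) (b, c) := by
  have hC := isTripleClosed_cl hR hT₀
  have hSfin := hR.subset hSR
  have hT₀S := hSR.trans hT₀
  have hLS := leafSet_mono hSR
  have hinfR : ∀ a b c, a ≠ b → Inferred (rel R) (leafSet R) a b c → rel (cl R) a b c := by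
    intro a b c hab h
    obtain ⟨ha, hb, hc⟩ := mem_leafSet_of_inferred hT₀ hab h
    exact (rel_cl_iff hR hT₀).2 ⟨hab, ha, hb, hc, fun T hT => h.separates T.finite_clusters
      T.isLaminar_clusters (fun _ _ _ => separates_of_rel hT.2) hab⟩
  have hmonoS : ∀ {a b c}, Inferred (rel S) (leafSet R) a b c →
      Inferred (rel R) (leafSet R) a b c := by
    rintro a b c ⟨L', hL, ha, hb, hc, h1, h2⟩
    have key : ∀ {u v}, AhoConn (rel S) L' u v → AhoConn (rel R) L' u v :=
      fun h => Relation.EqvGen.mono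
        (fun _ _ ⟨hu, hv, w, hw, hr⟩ => ⟨hu, hv, w, hw, hr.mono hSR⟩) _ _ h
    exact ⟨L', hL, ha, hb, hc, key h1, fun x hx => (h2 x hx).imp key key⟩
  have hrelS : ∀ a b c, rel S a b c → rel (cl R) a b c :=
    fun a b c h => (h.mono hSR).mono (subset_cl R)
  have hrelR : ∀ a b c, rel R a b c → rel (cl R) a b c := fun a b c h => h.mono (subset_cl R)
  constructor
  · rintro h a b c hr
    obtain ⟨t, ht, h1, rfl⟩ := hr
    refine hC.eqvGen_of_inferred hrelS (fun a b c hab h => hinfR a b c hab (hmonoS h))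
      ((mem_cl_iff hSfin hT₀S hLS h1).1 ?_)
    rw [h]
    exact subset_cl R ht
  · intro h
    have hall : ∀ a b c, rel (cl R) a b c →
        Relation.EqvGen (PairAdj (rel (cl R)) (rel S)) (a, c) (b, c) := by
      rintro a b c ⟨t, ht, h1, rfl⟩
      have hi := (mem_cl_iff hR hT₀ subset_rfl h1).1 ht
      -- Pairs of a triple of the closure are connected by edges of `R`, each of which is replaced
      -- by a path over `S`.
      refine eqvGen_of_forall ?_ (hC.eqvGen_of_inferred hrelR hinfR hi)
      rintro ⟨x, z⟩ ⟨y, z'⟩ (hb | ⟨rfl, hr⟩)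
      · exact .rel _ _ (.inl hb)
      · exact h _ _ _ hr
    ext t
    obtain ⟨a, b, hab⟩ := t.exists_pair_eq
    constructor
    · intro ht
      rw [mem_cl_iff hSfin hT₀S hLS hab] at ht
      exact (mem_cl_iff hR hT₀ subset_rfl hab).2 (hmonoS ht)
    · intro ht
      refine (mem_cl_iff hSfin hT₀S hLS hab).2 (hC.inferred_of_eqvGen hrelS (finite_leafSet hR)
        (fun a b c h => ?_) hall ⟨t, ht, hab, rfl⟩)
      rw [rel_cl_iff hR hT₀] at h
      exact ⟨h.2.1, h.2.2.1, h.2.2.2.1⟩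

end TripleSet

theorem mainTheorem1 {X : Type u} (R : Set (RootedTriple X)) (hfin : R.Finite)
    (hR : TripleSet.Consistent R) :
    ∃ M : Matroid (RootedTriple X),
      M.E = R ∧ ∀ I : Set (RootedTriple X), M.Indep I ↔ I ∈ TripleSet.indepFamily R := by
  obtain ⟨T, hT⟩ := hR
  -- An arbitrary orientation of each unordered pair; connectivity does not depend on it.
  choose e₁ e₂ he using fun t : RootedTriple X => t.exists_pair_eq
  obtain ⟨M, hM, hI⟩ := exists_matroid_of_connectivity (BaseAdj (TripleSet.rel (TripleSet.cl R)))
    (fun t : RootedTriple X => (e₁ t, t.out)) (fun t => (e₂ t, t.out)) hfin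
  refine ⟨M, hM, fun I => ?_⟩
  have key : ∀ S, S ⊆ R → ∀ p q, Relation.EqvGen (fun u v =>
        BaseAdj (TripleSet.rel (TripleSet.cl R)) u v ∨
          ∃ s ∈ S, u = (e₁ s, s.out) ∧ v = (e₂ s, s.out)) p q ↔
      Relation.EqvGen (PairAdj (TripleSet.rel (TripleSet.cl R)) (TripleSet.rel S)) p q := by
    intro S hS p q
    constructor <;> refine eqvGen_of_forall ?_
    · rintro _ _ (h | ⟨s, hs, rfl, rfl⟩)
      · exact .rel _ _ (.inl h)
      · exact .rel _ _ (.inr ⟨rfl, s, hs, he s, rfl⟩)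
    · rintro ⟨x, z⟩ ⟨y, z'⟩ (h | ⟨rfl, s, hs, h, rfl⟩)
      · exact .rel _ _ (.inl h)
      · rw [he s, Sym2.eq_iff] at h
        rcases h with ⟨rfl, rfl⟩ | ⟨rfl, rfl⟩
        · exact .rel _ _ (.inr ⟨s, hs, rfl, rfl⟩)
        · exact (Relation.EqvGen.rel _ _ (.inr ⟨s, hs, rfl, rfl⟩)).symm
  have hsc : ∀ S, (S ⊆ R ∧ ∀ r ∈ R, Relation.EqvGen (fun u v =>
        BaseAdj (TripleSet.rel (TripleSet.cl R)) u v ∨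
          ∃ s ∈ S, u = (e₁ s, s.out) ∧ v = (e₂ s, s.out)) (e₁ r, r.out) (e₂ r, r.out)) ↔
      S ∈ TripleSet.sc R := by
    intro S
    refine and_congr_right fun hS => ?_
    simp only [key S hS]
    rw [TripleSet.cl_eq_iff hfin hT hS]
    constructor
    · rintro h a b _ ⟨t, ht, h1, rfl⟩
      rw [he t, Sym2.eq_iff] at h1
      rcases h1 with ⟨rfl, rfl⟩ | ⟨rfl, rfl⟩
      · exact h t ht
      · exact (h t ht).symm
    · exact fun h r hr => h _ _ _ ⟨r, hr, he r, rfl⟩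
  rw [hI]
  simp only [hsc]
  rfl
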